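/- Let $\mathbb{F}$ be an algebraically closed field, let $m \geq 1$ be an integer such that $m+1$ is odd, and let $\mathbf{PG}(m,\mathbb{F})$ be the $m$-dimensional projective space whose points and lines are the one- and two-dimensional linear subspaces of $\mathbb{F}^{m+1}$, with incidence given by inclusion. Let $S$ be a Singer group of $\mathbf{PG}(m,\mathbb{F})$, that is, a group of automorphisms (permutations of the points which, together with their inverses, map lines to lines) of $\mathbf{PG}(m,\mathbb{F})$ acting sharply transitively on the points: for all points $p, q$ there is exactly one $g \in S$ with $g(p) = q$. (i) If $\operatorname{char}(\mathbb{F}) \neq 0$, then $S$ is torsion-free, i.e., the identity is the only element of finite order in $S$. (ii) If $\operatorname{char}(\mathbb{F}) = 0$ and $m = 2$, then $S$ is torsion-free. -/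

import Mathlib

open scoped LinearAlgebra.Projectivization

/-- A set of points of the projective space `ℙ K V` is a *line* if it is the set of points of
a projective subspace whose underlying vector subspace has dimension two. -/
def IsProjLine (K : Type*) {V : Type*} [Field K] [AddCommGroup V] [Module K V]
    (L : Set (ℙ K V)) : Prop :=
  ∃ W : Projectivization.Subspace K V,
    Module.finrank K W.submodule = 2 ∧ L = {p : ℙ K V | p ∈ W}

/-- The automorphism group of the point-line geometry of the projective space `ℙ K V`: all
permutations `g` of the points such that a set of points is a line if and only if its image
under `g` is a line. -/
def collineationGroup (K V : Type*) [Field K] [AddCommGroup V] [Module K V] :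
    Subgroup (Equiv.Perm (ℙ K V)) where
  carrier := {g | ∀ L : Set (ℙ K V), IsProjLine K (g '' L) ↔ IsProjLine K L}
  one_mem' := fun L => by
    rw [Equiv.Perm.coe_one, Set.image_id]
  mul_mem' := fun {a b} ha hb L => by
    rw [Equiv.Perm.coe_mul, Set.image_comp]
    exact (ha _).trans (hb L)
  inv_mem' := fun {a} ha L => by
    rw [← ha, ← Set.image_comp, ← Equiv.Perm.coe_mul, mul_inv_cancel, Equiv.Perm.coe_one,
      Set.image_id]

/-- A *Singer group* of the projective space `ℙ K V`: a group of automorphisms that acts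
sharply transitively on the points. -/
def IsSingerGroup {K V : Type*} [Field K] [AddCommGroup V] [Module K V]
    (S : Subgroup (collineationGroup K V)) : Prop :=
  ∀ p q : ℙ K V, ∃! g : S, (g : Equiv.Perm (ℙ K V)) p = q

/-- A (not necessarily commutative) group is *torsion-free* if its identity is its only element
of finite order. (For noncommutative groups `IsMulTorsionFree` is a stronger condition:
injectivity of all power maps.) -/
def IsTorsionFreeGroup (G : Type*) [Group G] : Prop :=
  ∀ g : G, IsOfFinOrder g → g = 1

/-!
A nontrivial element of finite order in a Singer group has a power of prime order `r`, and that power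
moves every point. So it is enough that every collineation `g` with `g ^ r = 1` fixes a point.

The number `n = m + 1` is odd, hence at least three, and the fundamental theorem of projective
geometry (`exists_semilinearMap_of_mem_collineationGroup`) says that `g` is induced by a map `φ` that
is semilinear with respect to an endomorphism `σ` of the field. It is proved by normalising
representatives on a hyperplane: for a vector `v` off the hyperplane, the representatives `f x` of the
images of points of the hyperplane are scaled so that `G v + f x` represents the image of the
point spanned by `v + x`. Intersecting lines then shows that `f` is additive, and its effect on
scalars gives `σ`.

As `g ^ r = 1`, the map `φ ^ r` is multiplication by a scalar and `σ ^ r = 1`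
(`exists_iterate_eq_smul`). A fixed point of `g` is a line through the origin that `φ` preserves.

* If `σ = 1`, then `φ` is linear and has an eigenvector, because the field is algebraically closed.
* If `σ ≠ 1`, then `r = 2` by a part of the Artin–Schreier theorem (`eq_two_of_pow_prime_eq_one`).
  For `r` equal to the characteristic, it rests on the equation `σ x = x - 1` and traces; for other
  odd `r`, on the equation `σ α = ζ * α` for a primitive `r`-th root of unity `ζ` and norms. Once
  `r = 2`, determinants and the oddness of `n` show that `φ` can be rescaled to an involution, which
  has a fixed vector or acts as `-1` on some vector
  (`exists_eq_smul_of_apply_apply_eq_smul`).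

The argument works in every characteristic and every even dimension `m`.
-/

/-! ### Automorphisms of prime order of an algebraically closed field -/

/-- Dedekind's independence of characters, for the powers of an endomorphism of prime order. -/
lemma exists_sum_mul_pow_ne_zero {F : Type*} [Field F] {σ : F →+* F} {r : ℕ} (hr : r.Prime)
    (hσr : σ ^ r = 1) (hσ : σ ≠ 1) {c : ℕ → F} (hc : c 0 ≠ 0) :
    ∃ x, ∑ i ∈ Finset.range r, c i * (σ ^ i) x ≠ 0 := by
  have := Fact.mk hr
  have ho : orderOf σ = r := orderOf_eq_prime hσr hσ
  have hinj : Function.Injective (fun i : Fin r => ((σ ^ (i : ℕ) : F →+* F) : F →* F)) := by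
    intro i j hij
    refine Fin.ext (pow_injOn_Iio_orderOf (x := σ) (by simp [ho]) (by simp [ho]) ?_)
    ext x
    exact DFunLike.congr_fun hij x
  have hli := (linearIndependent_monoidHom F F).comp _ hinj
  by_contra! h
  refine hc (Fintype.linearIndependent_iff.1 hli (fun i => c i) ?_ ⟨0, hr.pos⟩)
  ext x
  simpa [Finset.sum_range] using h x

lemma map_pow_apply_succ {F : Type*} [Field F] (σ : F →+* F) (i : ℕ) (x : F) :
    σ ((σ ^ i) x) = (σ ^ (i + 1)) x := by
  rw [pow_succ', RingHom.mul_def, RingHom.comp_apply]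

/-- The trace of `x` over the field fixed by `σ` is fixed by `σ`. -/
lemma map_sum_pow_apply {F : Type*} [Field F] {σ : F →+* F} {r : ℕ} (hσr : σ ^ r = 1) (x : F) :
    σ (∑ i ∈ Finset.range r, (σ ^ i) x) = ∑ i ∈ Finset.range r, (σ ^ i) x := by
  have h := Finset.sum_range_succ (fun i => (σ ^ i) x) r
  rw [Finset.sum_range_succ', hσr, pow_zero] at h
  rw [map_sum]
  simp only [map_pow_apply_succ]
  exact add_right_cancel h

/-- The norm of `x` over the field fixed by `σ` is fixed by `σ`. -/
lemma map_prod_pow_apply {F : Type*} [Field F] {σ : F →+* F} {r : ℕ} (hr : r ≠ 0)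
    (hσr : σ ^ r = 1) (x : F) :
    σ (∏ i ∈ Finset.range r, (σ ^ i) x) = ∏ i ∈ Finset.range r, (σ ^ i) x := by
  obtain ⟨n, rfl⟩ := Nat.exists_eq_succ_of_ne_zero hr
  rw [map_prod, Finset.prod_range_succ, Finset.prod_range_succ', map_pow_apply_succ, hσr, pow_zero]
  simp only [map_pow_apply_succ]

lemma pow_apply_eq_of_apply_eq {F : Type*} [Field F] {σ : F →+* F} {x : F} (h : σ x = x) (i : ℕ) :
    (σ ^ i) x = x := by
  induction i with
  | zero => simp
  | succ i ih => rw [← map_pow_apply_succ, ih, h]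

/-- A root of unity of prime order is fixed by every endomorphism of the same prime order, since
the automorphism group of `μ_r` has order `r - 1`. -/
lemma map_primitiveRoot_eq {F : Type*} [Field F] {σ : F →+* F} {r : ℕ} (hr : r.Prime)
    (hσr : σ ^ r = 1) {ζ : F} (hζ : IsPrimitiveRoot ζ r) : σ ζ = ζ := by
  have := Fact.mk hr
  obtain ⟨k, -, hk⟩ := hζ.eq_pow_of_pow_eq_one (ξ := σ ζ) (by rw [← map_pow, hζ.pow_eq_one, map_one])
  have hpow : ∀ i, (σ ^ i) ζ = ζ ^ k ^ i := by
    intro i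
    induction i with
    | zero => simp
    | succ i ih => rw [← map_pow_apply_succ, ih, map_pow, ← hk, ← pow_mul, pow_succ']
  have h1 := hpow r
  rw [hσr, RingHom.one_def, RingHom.id_apply] at h1
  have hmod : ∀ n, ζ ^ n = ζ ^ 1 ↔ n ≡ 1 [MOD r] := fun n => by
    have h := (hζ.isOfFinOrder hr.ne_zero).pow_eq_pow_iff_modEq (n := n) (m := 1)
    rwa [← hζ.eq_orderOf] at h
  have h2 : k ^ r ≡ 1 [MOD r] := (hmod _).1 (by rw [← h1, pow_one])
  have h3 : k ≡ 1 [MOD r] := by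
    rw [← ZMod.natCast_eq_natCast_iff] at h2 ⊢
    simpa using h2
  rw [← hk, (hmod k).2 h3, pow_one]

/-- An algebraically closed field of characteristic `p` has no automorphism of order `p`: the
Artin–Schreier map is surjective on the fixed field, because the trace is, while
`σ x = x - 1` makes `x ^ p - x` a fixed element. -/
lemma eq_one_of_pow_charP_eq_one {F : Type*} [Field F] [IsAlgClosed F] {p : ℕ} [hp : Fact p.Prime]
    [CharP F p] {σ : F →+* F} (hσp : σ ^ p = 1) : σ = 1 := by
  by_contra hσ
  obtain ⟨z, hz⟩ : ∃ z, ∑ i ∈ Finset.range p, (σ ^ i) z = 1 := by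
    obtain ⟨x, hx⟩ := exists_sum_mul_pow_ne_zero hp.out hσp hσ (c := fun _ => 1) one_ne_zero
    simp only [one_mul] at hx
    have hfix := pow_apply_eq_of_apply_eq (map_sum_pow_apply hσp x)
    refine ⟨(∑ i ∈ Finset.range p, (σ ^ i) x)⁻¹ * x, ?_⟩
    simp only [map_mul, map_inv₀, hfix, ← Finset.mul_sum]
    exact inv_mul_cancel₀ hx
  -- An explicit solution of `σ x = x - 1`.
  obtain ⟨x, hx⟩ : ∃ x, σ x = x - 1 := by
    refine ⟨∑ i ∈ Finset.range p, (i : F) * (σ ^ i) z, ?_⟩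
    have h1 := Finset.sum_range_succ (fun i => (i : F) * (σ ^ i) z) p
    rw [Finset.sum_range_succ', CharP.cast_eq_zero F p] at h1
    simp only [Nat.cast_add, Nat.cast_one, add_mul, one_mul, Finset.sum_add_distrib,
      Nat.cast_zero, zero_mul, add_zero, ← map_pow_apply_succ, ← map_sum, hz, map_one] at h1
    rw [eq_sub_iff_add_eq, map_sum, ← h1]
    simp
  obtain ⟨a, ha⟩ : ∃ a, a = x ^ p - x := ⟨_, rfl⟩
  have ha' : ∀ i, (σ ^ i) a = a := by
    refine pow_apply_eq_of_apply_eq ?_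
    rw [ha, map_sub, map_pow, hx, sub_pow_char]
    ring
  obtain ⟨y, hy⟩ : ∃ y : F, y ^ p - y = a * z := by
    have hd : (Polynomial.X ^ p - Polynomial.X - Polynomial.C (a * z) : Polynomial F).degree = p := by
      have h1 : (Polynomial.X ^ p - Polynomial.X : Polynomial F).degree = p := by
        rw [Polynomial.degree_sub_eq_left_of_degree_lt, Polynomial.degree_X_pow]
        rw [Polynomial.degree_X_pow, Polynomial.degree_X]
        exact_mod_cast hp.out.one_lt
      rw [Polynomial.degree_sub_eq_left_of_degree_lt, h1]
      rw [h1]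
      exact Polynomial.degree_C_le.trans_lt (by exact_mod_cast hp.out.pos)
    obtain ⟨y, hy⟩ := IsAlgClosed.exists_root
      (Polynomial.X ^ p - Polynomial.X - Polynomial.C (a * z))
      (by rw [hd]; exact_mod_cast hp.out.ne_zero)
    exact ⟨y, by simpa [Polynomial.IsRoot, sub_eq_zero] using hy⟩
  set k := ∑ i ∈ Finset.range p, (σ ^ i) y with hk
  have hk' : k ^ p - k = a := by
    rw [hk, sum_pow_char, ← Finset.sum_sub_distrib]
    simp only [← map_pow, ← map_sub, hy]
    simp only [map_mul, ha', ← Finset.mul_sum, hz, mul_one]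
  have hxk : (x - k) ^ p = x - k := by
    rw [sub_pow_char]
    linear_combination -hk' - ha
  have hmem : x - k ∈ (⊥ : Subfield F) := (Subfield.mem_bot_iff_pow_eq_self F p).2 hxk
  have hle : (⊥ : Subfield F) ≤ σ.eqLocusField (RingHom.id F) := bot_le
  have h1 : σ (x - k) = x - k := hle hmem
  rw [map_sub, hk, map_sum_pow_apply hσp, hx] at h1
  exact one_ne_zero (α := F) (by linear_combination -h1)

/-- In an algebraically closed field there is no automorphism of odd prime order `r` different
from the characteristic: if `σ α = ζ * α` with `ζ` of order `r`, then the norm of an `r`-th root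
of `α` is an `r`-th root of `α ^ r` fixed by `σ`. -/
lemma eq_one_of_pow_odd_prime_eq_one {F : Type*} [Field F] [IsAlgClosed F] {r : ℕ}
    (hr : r.Prime) (hodd : Odd r) (hrF : (r : F) ≠ 0) {σ : F →+* F} (hσr : σ ^ r = 1) :
    σ = 1 := by
  by_contra hσ
  have : NeZero (r : F) := ⟨hrF⟩
  obtain ⟨ζ, hζ⟩ : ∃ ζ : F, IsPrimitiveRoot ζ r := by
    obtain ⟨ζ, h⟩ := IsAlgClosed.exists_root (Polynomial.cyclotomic r F)
      (by rw [Polynomial.degree_cyclotomic]; exact_mod_cast (Nat.totient_pos.2 hr.pos).ne')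
    exact ⟨ζ, Polynomial.isRoot_cyclotomic_iff.1 h⟩
  have hσζ := map_primitiveRoot_eq hr hσr hζ
  have hζ0 : ζ ≠ 0 := hζ.ne_zero hr.ne_zero
  -- The Lagrange resolvent is an eigenvector of `σ`.
  obtain ⟨α, hα0, hα⟩ : ∃ α : F, α ≠ 0 ∧ σ α = ζ * α := by
    obtain ⟨x, hx⟩ := exists_sum_mul_pow_ne_zero hr hσr hσ (c := fun i => ζ⁻¹ ^ i) (by simp)
    refine ⟨_, hx, ?_⟩
    have h := Finset.sum_range_succ (fun i => ζ⁻¹ ^ i * (σ ^ i) x) r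
    rw [Finset.sum_range_succ', hσr, inv_pow _ r, hζ.pow_eq_one, inv_one, pow_zero, pow_zero] at h
    rw [map_sum, ← add_right_cancel h, Finset.mul_sum]
    refine Finset.sum_congr rfl fun i _ => ?_
    rw [map_mul, map_pow, map_inv₀, hσζ, map_pow_apply_succ, pow_succ' ζ⁻¹,
      mul_assoc ζ⁻¹, mul_inv_cancel_left₀ hζ0]
  have hpowα : ∀ i, (σ ^ i) α = ζ ^ i * α := by
    intro i
    induction i with
    | zero => simp
    | succ i ih => rw [← map_pow_apply_succ, ih, map_mul, map_pow, hσζ, hα]; ring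
  obtain ⟨β, hβ⟩ := IsAlgClosed.exists_pow_nat_eq α hr.pos
  obtain ⟨b, hb⟩ : ∃ b, b = ∏ i ∈ Finset.range r, (σ ^ i) β := ⟨_, rfl⟩
  have hσb : σ b = b := by rw [hb, map_prod_pow_apply hr.ne_zero hσr]
  have hbr : b ^ r = α ^ r := by
    rw [hb, ← Finset.prod_pow]
    simp only [← map_pow, hβ, hpowα]
    rw [Finset.prod_mul_distrib, Finset.prod_pow_eq_pow_sum, Finset.prod_const,
      Finset.card_range]
    -- As `r` is odd, `r` divides `0 + 1 + ⋯ + (r - 1)`.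
    have : r ∣ ∑ i ∈ Finset.range r, i := by
      have h2 := Finset.sum_range_id_mul_two r
      exact (Nat.Coprime.dvd_mul_right (Nat.Coprime.symm (Nat.coprime_two_left.2 hodd))).1
        (h2 ▸ dvd_mul_right _ _)
    rw [(hζ.pow_eq_one_iff_dvd _).2 this, one_mul]
  have hb0 : b ≠ 0 := by
    rintro rfl
    rw [zero_pow hr.ne_zero] at hbr
    exact hα0 (pow_eq_zero_iff hr.ne_zero |>.1 hbr.symm)
  have : NeZero r := ⟨hr.ne_zero⟩
  obtain ⟨j, -, hj⟩ := hζ.eq_pow_of_pow_eq_one (ξ := α / b)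
    (by rw [div_pow, hbr, div_self (pow_ne_zero _ hα0)])
  have hσα : σ α = α := by
    have : α = ζ ^ j * b := by rw [hj, div_mul_cancel₀ _ hb0]
    rw [this, map_mul, map_pow, hσζ, hσb]
  refine hζ.ne_one hr.one_lt (mul_right_cancel₀ hα0 ?_)
  rw [← hα, hσα, one_mul]

/-- The part of the Artin–Schreier theorem that the argument uses: a nontrivial automorphism of
prime order of an algebraically closed field is an involution. -/
theorem eq_two_of_pow_prime_eq_one {F : Type*} [Field F] [IsAlgClosed F] {r : ℕ}
    (hr : r.Prime) {σ : F →+* F} (hσr : σ ^ r = 1) (hσ : σ ≠ 1) : r = 2 := by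
  by_contra h2
  by_cases hrF : (r : F) = 0
  · have := Fact.mk hr
    have : CharP F r := (CharP.charP_iff_prime_eq_zero hr).2 hrF
    exact hσ (eq_one_of_pow_charP_eq_one hσr)
  · exact hσ (eq_one_of_pow_odd_prime_eq_one hr (hr.odd_of_ne_two h2) hrF hσr)

/-! ### The fundamental theorem of projective geometry -/

section FundamentalTheorem

variable {K V : Type*} [Field K] [AddCommGroup V] [Module K V]

/-- A choice of representative vectors for a collineation: `G x` spans the image of the point
spanned by `x`. Collinearity is expressed by membership in the span of two vectors, so degenerate
lines are allowed, and `mem_span_pair_iff` also says that points go to points injectively. -/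
structure IsCollineationLift (K : Type*) {V : Type*} [Field K] [AddCommGroup V] [Module K V]
    (G : V → V) : Prop where
  map_zero : G 0 = 0
  mem_span_pair_iff : ∀ x y z : V,
    z ∈ Submodule.span K {x, y} ↔ G z ∈ Submodule.span K {G x, G y}

/-- The normalisation of `G` on the hyperplane `ker h` with respect to a vector `v` off it: for `x`
in `ker h`, the vector `f x` is the multiple of `G x` such that `G v + f x` spans the image of the
point spanned by `v + x`. Values of `f` off `ker h` are irrelevant. -/
structure IsAffineLift (G : V → V) (h : V →ₗ[K] K) (v : V) (f : V → V) : Prop where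
  apply_base : h v = 1
  exists_eq_smul : ∀ x, h x = 0 → ∃ a : K, a ≠ 0 ∧ f x = a • G x
  exists_map_add : ∀ x, h x = 0 → ∃ c : K, G (v + x) = c • (G v + f x)

lemma linearIndependent_smul_left {x u : V} (hxu : LinearIndependent K ![x, u]) {c : K}
    (hc : c ≠ 0) : LinearIndependent K ![c • x, u] := by
  rw [LinearIndependent.pair_iff] at hxu ⊢
  intro s t h
  rw [smul_smul] at h
  obtain ⟨h1, h2⟩ := hxu _ _ h
  exact ⟨(mul_eq_zero.1 h1).resolve_right hc, h2⟩

lemma linearIndependent_smul_add_right {x u : V} (hxu : LinearIndependent K ![x, u]) (c : K) :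
    LinearIndependent K ![x, c • x + u] := by
  rw [LinearIndependent.pair_iff] at hxu ⊢
  intro s t h
  obtain ⟨h1, rfl⟩ := hxu (s + t * c) t (by rw [← h]; module)
  exact ⟨by simpa using h1, rfl⟩

namespace IsCollineationLift

variable {G : V → V}

lemma eq_zero_iff (hG : IsCollineationLift K G) {x : V} : G x = 0 ↔ x = 0 := by
  have h := hG.mem_span_pair_iff 0 0 x
  simpa [hG.map_zero] using h.symm

/-- `G` preserves degenerate lines, that is, equality of points. -/
lemma exists_eq_smul_iff (hG : IsCollineationLift K G) {x y : V} :
    (∃ a : K, a • G x = G y) ↔ ∃ a : K, a • x = y := by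
  have h := hG.mem_span_pair_iff x x y
  simpa [Submodule.mem_span_singleton] using h.symm

lemma exists_map_smul (hG : IsCollineationLift K G) (x : V) {a : K} (ha : a ≠ 0) :
    ∃ e : K, e ≠ 0 ∧ G (a • x) = e • G x := by
  by_cases hx : x = 0
  · exact ⟨1, one_ne_zero, by simp [hx, hG.map_zero]⟩
  obtain ⟨e, he⟩ := hG.exists_eq_smul_iff.2 ⟨a, rfl⟩
  refine ⟨e, ?_, he.symm⟩
  rintro rfl
  rw [zero_smul, eq_comm, hG.eq_zero_iff] at he
  exact smul_ne_zero ha hx he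

lemma exists_isAffineLift (hG : IsCollineationLift K G) {h : V →ₗ[K] K} {v : V} (hv : h v = 1) :
    ∃ f, IsAffineLift G h v f := by
  have key : ∀ x, ∃ w, h x = 0 →
      (∃ a : K, a ≠ 0 ∧ w = a • G x) ∧ ∃ c : K, G (v + x) = c • (G v + w) := by
    intro x
    by_cases hx : h x = 0
    swap
    · exact ⟨0, fun h => absurd h hx⟩
    by_cases hx0 : x = 0
    · exact ⟨0, fun _ => ⟨⟨1, one_ne_zero, by simp [hx0, hG.map_zero]⟩, 1, by simp [hx0]⟩⟩
    have hmem : G (v + x) ∈ Submodule.span K {G v, G x} :=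
      (hG.mem_span_pair_iff _ _ _).1 (Submodule.mem_span_pair.2 ⟨1, 1, by simp⟩)
    obtain ⟨c, b, hcb⟩ := Submodule.mem_span_pair.1 hmem
    have hc : c ≠ 0 := by
      rintro rfl
      obtain ⟨a, ha⟩ := hG.exists_eq_smul_iff.1 ⟨b, by simpa using hcb⟩
      simpa [hx, hv] using congrArg h ha
    have hb : b ≠ 0 := by
      rintro rfl
      obtain ⟨a, ha⟩ := hG.exists_eq_smul_iff.1 ⟨c, by simpa using hcb⟩
      have ha1 : a = 1 := by simpa [hx, hv] using congrArg h ha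
      rw [ha1, one_smul, left_eq_add] at ha
      exact hx0 ha
    refine ⟨(c⁻¹ * b) • G x, fun _ => ⟨⟨_, mul_ne_zero (inv_ne_zero hc) hb, rfl⟩, c, ?_⟩⟩
    rw [smul_add, smul_smul, mul_inv_cancel_left₀ hc, hcb]
  choose f hf using key
  exact ⟨f, hv, fun x hx => (hf x hx).1, fun x hx => (hf x hx).2⟩

end IsCollineationLift

namespace IsAffineLift

variable {G f : V → V} {h : V →ₗ[K] K} {v : V}

lemma map_zero (hf : IsAffineLift G h v f) (hG : IsCollineationLift K G) : f 0 = 0 := by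
  obtain ⟨a, -, ha⟩ := hf.exists_eq_smul 0 (by simp)
  rw [ha, hG.map_zero, smul_zero]

lemma ne_zero (hf : IsAffineLift G h v f) (hG : IsCollineationLift K G) {x : V} (hx : h x = 0)
    (hx0 : x ≠ 0) : f x ≠ 0 := by
  obtain ⟨a, ha0, ha⟩ := hf.exists_eq_smul x hx
  rw [ha]
  exact smul_ne_zero ha0 (mt hG.eq_zero_iff.1 hx0)

/-- `f` preserves membership in the span of two vectors of `ker h`. -/
lemma exists_eq_smul_add_smul (hf : IsAffineLift G h v f) (hG : IsCollineationLift K G)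
    {x y z : V} (hx : h x = 0) (hy : h y = 0) (hz : z ∈ Submodule.span K {x, y}) :
    ∃ p q : K, G z = p • f x + q • f y := by
  obtain ⟨a, ha0, ha⟩ := hf.exists_eq_smul x hx
  obtain ⟨b, hb0, hb⟩ := hf.exists_eq_smul y hy
  obtain ⟨p, q, hpq⟩ := Submodule.mem_span_pair.1 ((hG.mem_span_pair_iff _ _ _).1 hz)
  refine ⟨p * a⁻¹, q * b⁻¹, ?_⟩
  rw [ha, hb, smul_smul, smul_smul, inv_mul_cancel_right₀ ha0, inv_mul_cancel_right₀ hb0, hpq]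

/-- Collineations preserve linear independence of `v`, `x`, `y`. -/
lemma eq_zero_of_smul_add_eq_zero (hf : IsAffineLift G h v f) (hG : IsCollineationLift K G)
    {x y : V} (hx : h x = 0) (hy : h y = 0) (hxy : LinearIndependent K ![x, y]) {α β γ : K}
    (h0 : α • G v + β • f x + γ • f y = 0) : α = 0 ∧ β = 0 ∧ γ = 0 := by
  obtain ⟨a, ha0, ha⟩ := hf.exists_eq_smul x hx
  obtain ⟨b, hb0, hb⟩ := hf.exists_eq_smul y hy
  have hx0 : x ≠ 0 := by simpa using hxy.ne_zero 0
  have hα : α = 0 := by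
    by_contra hα
    have hmem : G v ∈ Submodule.span K {G x, G y} := by
      refine Submodule.mem_span_pair.2 ⟨-(α⁻¹ * β * a), -(α⁻¹ * γ * b), ?_⟩
      have h1 : G v = α⁻¹ • (α • G v) := by rw [smul_smul, inv_mul_cancel₀ hα, one_smul]
      have h2 : α • G v = -(β • f x) - γ • f y := by
        rw [← sub_eq_zero, ← h0]; abel
      rw [h1, h2, ha, hb]
      module
    obtain ⟨p, q, hpq⟩ := Submodule.mem_span_pair.1 ((hG.mem_span_pair_iff _ _ _).2 hmem)
    simpa [hx, hy, hf.apply_base] using congrArg h hpq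
  subst hα
  have hγ : γ = 0 := by
    by_contra hγ
    have h2 : γ • f y = -(β • f x) := by
      rw [← sub_eq_zero, ← h0]; module
    obtain ⟨c, hc⟩ := (hG.exists_eq_smul_iff (x := x) (y := y)).1 ⟨-((γ * b)⁻¹ * (β * a)), by
      have h1 : G y = (γ * b)⁻¹ • (γ • f y) := by
        rw [hb, smul_smul γ, smul_smul, inv_mul_cancel₀ (mul_ne_zero hγ hb0), one_smul]
      rw [h1, h2, ha]
      module⟩
    exact (LinearIndependent.pair_iff' hx0).1 hxy c hc
  subst hγ
  refine ⟨rfl, ?_, rfl⟩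
  rw [zero_smul, zero_smul, zero_add, add_zero] at h0
  exact (smul_eq_zero.1 h0).resolve_right (hf.ne_zero hG hx hx0)

/-- The point spanned by `v + x + y` lies on the lines joining `v + x` to `y` and `v` to `x + y`. -/
lemma exists_map_add_eq (hf : IsAffineLift G h v f) (hG : IsCollineationLift K G)
    {x y : V} (hx : h x = 0) (hy : h y = 0) (hxy : LinearIndependent K ![x, y]) :
    ∃ q : K, f (x + y) = f x + q • f y := by
  have hz : h (x + y) = 0 := by rw [map_add, hx, hy, add_zero]
  obtain ⟨a, -, ha⟩ := hf.exists_eq_smul _ hz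
  obtain ⟨p, q, hpq⟩ := hf.exists_eq_smul_add_smul hG hx hy
    (Submodule.mem_span_pair.2 ⟨1, 1, by rw [one_smul, one_smul]⟩)
  rw [hpq, smul_add, smul_smul, smul_smul] at ha
  obtain ⟨c, hc⟩ := hf.exists_map_add _ hz
  obtain ⟨d, hd⟩ := hf.exists_map_add _ hx
  obtain ⟨b, hb0, hb⟩ := hf.exists_eq_smul y hy
  have hc0 : c ≠ 0 := by
    rintro rfl
    rw [zero_smul, hG.eq_zero_iff] at hc
    simpa [hz, hf.apply_base] using congrArg h hc
  obtain ⟨s, t, hst⟩ := Submodule.mem_span_pair.1 <|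
    (hG.mem_span_pair_iff (v + x) y (v + (x + y))).1 <|
      Submodule.mem_span_pair.2 ⟨1, 1, by rw [one_smul, one_smul, add_assoc]⟩
  have hGy : G y = b⁻¹ • f y := by rw [hb, smul_smul, inv_mul_cancel₀ hb0, one_smul]
  rw [hc, hd, ha, hGy] at hst
  obtain ⟨h1, h2, -⟩ := hf.eq_zero_of_smul_add_eq_zero hG hx hy hxy
    (α := c - s * d) (β := c * (a * p) - s * d) (γ := c * (a * q) - t * b⁻¹) (by
      rw [← sub_eq_zero.2 hst.symm]; module)
  have h3 : a * p = 1 := mul_left_cancel₀ hc0 (by linear_combination h2 - h1)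
  exact ⟨a * q, by rw [ha, h3, one_smul]⟩

lemma map_add_of_linearIndependent (hf : IsAffineLift G h v f) (hG : IsCollineationLift K G)
    {x y : V} (hx : h x = 0) (hy : h y = 0) (hxy : LinearIndependent K ![x, y]) :
    f (x + y) = f x + f y := by
  obtain ⟨q, hq⟩ := hf.exists_map_add_eq hG hx hy hxy
  obtain ⟨p, hp⟩ := hf.exists_map_add_eq hG hy hx (LinearIndependent.pair_symm_iff.1 hxy)
  rw [add_comm y, hq] at hp
  obtain ⟨-, -, h3⟩ := hf.eq_zero_of_smul_add_eq_zero hG hx hy hxy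
    (α := 0) (β := 1 - p) (γ := q - 1) (by rw [← sub_eq_zero.2 hp]; module)
  rw [hq, sub_eq_zero.1 h3, one_smul]

lemma exists_linearIndependent (hf : IsAffineLift G h v f)
    (h3 : ∀ x y : V, Submodule.span K {x, y} ≠ ⊤) {x : V} (hx0 : x ≠ 0) :
    ∃ u, h u = 0 ∧ LinearIndependent K ![x, u] := by
  obtain ⟨u, hu⟩ : ∃ u, u ∉ Submodule.span K {v, x} := by
    by_contra! hu
    exact h3 v x (eq_top_iff.2 fun u _ => hu u)
  refine ⟨u - h u • v, by simp [hf.apply_base], (LinearIndependent.pair_iff' hx0).2 ?_⟩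
  intro a ha
  exact hu (Submodule.mem_span_pair.2 ⟨h u, a, by rw [ha]; abel⟩)

lemma map_add (hf : IsAffineLift G h v f) (hG : IsCollineationLift K G)
    (h3 : ∀ x y : V, Submodule.span K {x, y} ≠ ⊤) {x y : V} (hx : h x = 0) (hy : h y = 0) :
    f (x + y) = f x + f y := by
  by_cases hx0 : x = 0
  · rw [hx0, zero_add, hf.map_zero hG, zero_add]
  by_cases hxy : LinearIndependent K ![x, y]
  · exact hf.map_add_of_linearIndependent hG hx hy hxy
  obtain ⟨c, rfl⟩ : ∃ c : K, c • x = y := by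
    rw [LinearIndependent.pair_iff' hx0] at hxy
    push Not at hxy
    exact hxy
  -- For dependent `x` and `y`, compare through a vector `u` independent of both.
  obtain ⟨u, hu, hxu⟩ := hf.exists_linearIndependent h3 hx0
  have hsmul : ∀ d : K, f (d • x + u) = f (d • x) + f u := by
    intro d
    by_cases hd : d = 0
    · rw [hd, zero_smul, zero_add, hf.map_zero hG, zero_add]
    · exact hf.map_add_of_linearIndependent hG (by simp [hx]) hu (linearIndependent_smul_left hxu hd)
  have h1 := hf.map_add_of_linearIndependent hG hx (by simp [hx, hu])
    (linearIndependent_smul_add_right hxu c)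
  have h2 := hsmul (1 + c)
  rw [hsmul c] at h1
  rw [add_smul, one_smul, add_assoc, h1, ← add_assoc] at h2
  exact (add_right_cancel h2).symm

lemma exists_map_smul (hf : IsAffineLift G h v f) (hG : IsCollineationLift K G)
    {x : V} (hx : h x = 0) (a : K) : ∃ s : K, f (a • x) = s • f x := by
  have hax : h (a • x) = 0 := by simp [hx]
  obtain ⟨b, -, hb⟩ := hf.exists_eq_smul _ hax
  obtain ⟨p, q, hpq⟩ := hf.exists_eq_smul_add_smul hG hx hx
    (Submodule.mem_span_pair.2 ⟨a, 0, by rw [zero_smul, add_zero]⟩)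
  exact ⟨b * (p + q), by rw [hb, hpq]; module⟩

lemma map_smul_of_linearIndependent (hf : IsAffineLift G h v f) (hG : IsCollineationLift K G)
    (h3 : ∀ x y : V, Submodule.span K {x, y} ≠ ⊤) {x y : V} (hx : h x = 0) (hy : h y = 0)
    (hxy : LinearIndependent K ![x, y]) {a s : K} (hs : f (a • x) = s • f x) :
    f (a • y) = s • f y := by
  obtain ⟨t, ht⟩ := hf.exists_map_smul hG hy a
  obtain ⟨u, hu⟩ := hf.exists_map_smul hG (x := x + y) (by simp [hx, hy]) a
  rw [smul_add, hf.map_add hG h3 (by simp [hx]) (by simp [hy]), hs, ht, hf.map_add hG h3 hx hy] at hu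
  obtain ⟨-, h1, h2⟩ := hf.eq_zero_of_smul_add_eq_zero hG hx hy hxy
    (α := 0) (β := s - u) (γ := t - u) (by rw [← sub_eq_zero.2 hu]; module)
  rw [ht, sub_eq_zero.1 h2, sub_eq_zero.1 h1]

/-- The factor by which `f` transforms the scalar `a` does not depend on the vector. -/
lemma map_smul_of_map_smul (hf : IsAffineLift G h v f) (hG : IsCollineationLift K G)
    (h3 : ∀ x y : V, Submodule.span K {x, y} ≠ ⊤) {x y : V} (hx : h x = 0) (hx0 : x ≠ 0)
    (hy : h y = 0) {a s : K} (hs : f (a • x) = s • f x) : f (a • y) = s • f y := by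
  by_cases hy0 : y = 0
  · simp [hy0, hf.map_zero hG]
  by_cases hxy : LinearIndependent K ![x, y]
  · exact hf.map_smul_of_linearIndependent hG h3 hx hy hxy hs
  obtain ⟨c, rfl⟩ : ∃ c : K, c • x = y := by
    rw [LinearIndependent.pair_iff' hx0] at hxy
    push Not at hxy
    exact hxy
  obtain ⟨u, hu, hxu⟩ := hf.exists_linearIndependent h3 hx0
  have hyu := linearIndependent_smul_left hxu (left_ne_zero_of_smul hy0)
  exact hf.map_smul_of_linearIndependent hG h3 hu hy (LinearIndependent.pair_symm_iff.1 hyu)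
    (hf.map_smul_of_linearIndependent hG h3 hx hu hxu hs)

lemma exists_ringHom (hf : IsAffineLift G h v f) (hG : IsCollineationLift K G)
    (h3 : ∀ x y : V, Submodule.span K {x, y} ≠ ⊤) :
    ∃ σ : K →+* K, ∀ (a : K) (x : V), h x = 0 → f (a • x) = σ a • f x := by
  have hv0 : v ≠ 0 := by
    rintro rfl
    simpa using hf.apply_base
  obtain ⟨x, hx, hvx⟩ := hf.exists_linearIndependent h3 hv0
  have hx0 : x ≠ 0 := by simpa using hvx.ne_zero 1
  have hfx := hf.ne_zero hG hx hx0
  choose s hs using fun a => hf.exists_map_smul hG hx a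
  have hs' : ∀ (a : K) (y : V), h y = 0 → f (a • y) = s a • f y := fun a y hy =>
    hf.map_smul_of_map_smul hG h3 hx hx0 hy (hs a)
  have hinj : Function.Injective fun a : K => a • f x := smul_left_injective K hfx
  refine ⟨⟨⟨⟨s, ?_⟩, ?_⟩, ?_, ?_⟩, hs'⟩
  · exact hinj (by simp only [← hs, one_smul])
  · intro a b
    refine hinj ?_
    simp only
    rw [mul_smul, ← hs, ← hs, mul_smul, hs' a _ (by simp [hx])]
  · exact hinj (by simp only [← hs, zero_smul, hf.map_zero hG])
  · intro a b
    refine hinj ?_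
    simp only
    rw [add_smul, ← hs, ← hs, ← hs, add_smul, hf.map_add hG h3 (by simp [hx]) (by simp [hx])]

end IsAffineLift

/-- The fundamental theorem of projective geometry: in dimension at least three, a collineation is
induced by a semilinear map. -/
theorem IsCollineationLift.exists_semilinearMap {G : V → V} (hG : IsCollineationLift K G)
    (h3 : ∀ x y : V, Submodule.span K {x, y} ≠ ⊤) :
    ∃ (σ : K →+* K) (φ : V →ₛₗ[σ] V), ∀ x, ∃ a : K, a ≠ 0 ∧ φ x = a • G x := by
  obtain ⟨v, hv0⟩ : ∃ v : V, v ≠ 0 := by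
    by_contra! hv
    exact h3 0 0 (eq_top_iff.2 fun u _ => by simp [hv u])
  obtain ⟨h, hv⟩ : ∃ h : V →ₗ[K] K, h v = 1 := by
    have := (Module.forall_dual_apply_eq_zero_iff K v).not.2 hv0
    push Not at this
    obtain ⟨φ, hφ⟩ := this
    exact ⟨(φ v)⁻¹ • φ, by simp [hφ]⟩
  obtain ⟨f, hf⟩ := hG.exists_isAffineLift hv
  obtain ⟨σ, hσ⟩ := hf.exists_ringHom hG h3
  have hker : ∀ x, h (x - h x • v) = 0 := fun x => by simp [hv]
  refine ⟨σ, ⟨⟨fun x => σ (h x) • G v + f (x - h x • v), ?_⟩, ?_⟩, ?_⟩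
  · intro x y
    have : x + y - h (x + y) • v = (x - h x • v) + (y - h y • v) := by rw [map_add]; module
    rw [this, hf.map_add hG h3 (hker x) (hker y), map_add, map_add]
    module
  · intro a x
    have : a • x - h (a • x) • v = a • (x - h x • v) := by rw [map_smul, smul_eq_mul]; module
    simp only
    rw [this, hσ _ _ (hker x), map_smul, smul_eq_mul, map_mul]
    module
  · intro x
    by_cases hx : h x = 0
    · obtain ⟨a, ha0, ha⟩ := hf.exists_eq_smul x hx
      exact ⟨a, ha0, by simp [hx, ha]⟩
    -- Rescale `x` so that it takes the form `v + y` with `y` in `ker h`.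
    obtain ⟨c, hc⟩ := hf.exists_map_add ((h x)⁻¹ • (x - h x • v)) (by simp [hker])
    have hvx : v + (h x)⁻¹ • (x - h x • v) = (h x)⁻¹ • x := by
      rw [smul_sub, smul_smul, inv_mul_cancel₀ hx, one_smul]; abel
    obtain ⟨e, he0, he⟩ := hG.exists_map_smul x (inv_ne_zero hx)
    rw [hvx, he, hσ _ _ (hker x), map_inv₀] at hc
    have hσx : σ (h x) ≠ 0 := (map_ne_zero σ).2 hx
    have hx0 : x ≠ 0 := by rintro rfl; simp at hx
    have hc0 : c ≠ 0 := by
      rintro rfl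
      rw [zero_smul] at hc
      exact smul_ne_zero he0 (mt hG.eq_zero_iff.1 hx0) hc
    refine ⟨σ (h x) * c⁻¹ * e, mul_ne_zero (mul_ne_zero hσx (inv_ne_zero hc0)) he0, ?_⟩
    change σ (h x) • G v + f (x - h x • v) = _
    rw [mul_smul, hc, smul_smul, inv_mul_cancel_right₀ hc0, smul_add, smul_smul,
      mul_inv_cancel₀ hσx, one_smul]

end FundamentalTheorem

/-! ### Collineations of a projective space and their representatives -/

section Collineations

variable {K V : Type*} [Field K] [AddCommGroup V] [Module K V]

open Projectivization in
lemma mem_span_pair_iff_exists_isProjLine {x y z : V} (hx : x ≠ 0) (hy : y ≠ 0) (hz : z ≠ 0)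
    (hxy : mk K x hx ≠ mk K y hy) :
    z ∈ Submodule.span K {x, y} ↔
      ∃ L : Set (ℙ K V), IsProjLine K L ∧ mk K x hx ∈ L ∧ mk K y hy ∈ L ∧ mk K z hz ∈ L := by
  have hli : LinearIndependent K ![y, x] := by
    rw [LinearIndependent.pair_iff' hy]
    exact fun a ha => hxy ((mk_eq_mk_iff' K _ _ _ _).2 ⟨a, ha⟩)
  have hfin : Module.finrank K (Submodule.span K {x, y}) = 2 := by
    have := finrank_span_eq_card hli
    rwa [Matrix.range_cons_cons_empty, Fintype.card_fin, Set.pair_comm] at this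
  have hmem : ∀ (W : Projectivization.Subspace K V) {u : V} (hu : u ≠ 0),
      mk K u hu ∈ W ↔ u ∈ Subspace.submodule W := fun W u hu =>
    (Subspace.mem_submodule_iff W hu).symm
  constructor
  · intro h
    refine ⟨_, ⟨Subspace.submodule.symm (Submodule.span K {x, y}), ?_, rfl⟩, ?_, ?_, ?_⟩
    · rw [OrderIso.apply_symm_apply, hfin]
    all_goals rw [Set.mem_ofPred_eq, hmem, OrderIso.apply_symm_apply]
    · exact Submodule.subset_span (by simp)
    · exact Submodule.subset_span (by simp)
    · exact h
  · rintro ⟨_, ⟨W, hW, rfl⟩, h1, h2, h3⟩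
    rw [Set.mem_ofPred_eq, hmem] at h1 h2 h3
    have : Module.Finite K (Subspace.submodule W) := Module.finite_of_finrank_pos (by omega)
    have hle : Submodule.span K {x, y} ≤ Subspace.submodule W := by
      rw [Submodule.span_le]
      rintro u (rfl | rfl)
      exacts [h1, h2]
    rwa [Submodule.eq_of_le_of_finrank_eq hle (by rw [hfin, hW])]

open Classical in
/-- The function on vectors that sends `x` to the chosen representative of the image under `g` of the
point spanned by `x`, and `0` to `0`. It is constant on each punctured line through the origin. -/
noncomputable def pointMapLift (g : Equiv.Perm (ℙ K V)) (x : V) : V :=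
  if hx : x = 0 then 0 else (g (Projectivization.mk K x hx)).rep

lemma pointMapLift_zero (g : Equiv.Perm (ℙ K V)) : pointMapLift g 0 = 0 := by
  simp [pointMapLift]

lemma pointMapLift_of_ne_zero (g : Equiv.Perm (ℙ K V)) {x : V} (hx : x ≠ 0) :
    pointMapLift g x = (g (Projectivization.mk K x hx)).rep := by
  simp [pointMapLift, hx]

lemma pointMapLift_ne_zero (g : Equiv.Perm (ℙ K V)) {x : V} (hx : x ≠ 0) :
    pointMapLift g x ≠ 0 := by
  rw [pointMapLift_of_ne_zero g hx]
  exact Projectivization.rep_nonzero _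

lemma mk_pointMapLift (g : Equiv.Perm (ℙ K V)) {x : V} (hx : x ≠ 0) :
    Projectivization.mk K (pointMapLift g x) (pointMapLift_ne_zero g hx)
      = g (Projectivization.mk K x hx) := by
  simp [pointMapLift_of_ne_zero g hx]

lemma mem_span_singleton_iff_pointMapLift (g : Equiv.Perm (ℙ K V)) (x z : V) :
    z ∈ Submodule.span K {x} ↔ pointMapLift g z ∈ Submodule.span K {pointMapLift g x} := by
  by_cases hz : z = 0
  · simp [hz, pointMapLift_zero]
  by_cases hx : x = 0
  · simp [hx, hz, pointMapLift_zero, pointMapLift_ne_zero]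
  rw [Submodule.mem_span_singleton, Submodule.mem_span_singleton,
    ← Projectivization.mk_eq_mk_iff' K z x hz hx,
    ← Projectivization.mk_eq_mk_iff' K _ _ (pointMapLift_ne_zero g hz) (pointMapLift_ne_zero g hx),
    mk_pointMapLift, mk_pointMapLift, g.injective.eq_iff]

theorem isCollineationLift_pointMapLift {g : Equiv.Perm (ℙ K V)} (hg : g ∈ collineationGroup K V) :
    IsCollineationLift K (pointMapLift g) := by
  refine ⟨pointMapLift_zero g, fun x y z => ?_⟩
  by_cases hx : x = 0
  · simpa [hx, pointMapLift_zero] using mem_span_singleton_iff_pointMapLift g y z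
  by_cases hy : y = 0
  · simpa [hy, pointMapLift_zero, Set.pair_comm _ (0 : V)] using
      mem_span_singleton_iff_pointMapLift g x z
  by_cases hz : z = 0
  · simp [hz, pointMapLift_zero]
  by_cases hxy : Projectivization.mk K x hx = Projectivization.mk K y hy
  · have hG : pointMapLift g y = pointMapLift g x := by
      rw [pointMapLift_of_ne_zero g hx, pointMapLift_of_ne_zero g hy, hxy]
    obtain ⟨a, ha⟩ := (Projectivization.mk_eq_mk_iff' K _ _ _ _).1 hxy.symm
    have hspan : Submodule.span K {x, y} = Submodule.span K {x} := by
      rw [Set.pair_comm]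
      exact Submodule.span_insert_eq_span (Submodule.mem_span_singleton.2 ⟨a, ha⟩)
    rw [hG, Set.pair_eq_singleton, hspan]
    exact mem_span_singleton_iff_pointMapLift g x z
  rw [mem_span_pair_iff_exists_isProjLine hx hy hz hxy,
    mem_span_pair_iff_exists_isProjLine (pointMapLift_ne_zero g hx) (pointMapLift_ne_zero g hy)
      (pointMapLift_ne_zero g hz)
      (by rwa [mk_pointMapLift, mk_pointMapLift, Ne, g.injective.eq_iff])]
  simp only [mk_pointMapLift g hx, mk_pointMapLift g hy, mk_pointMapLift g hz]
  constructor
  · rintro ⟨L, hL, h1, h2, h3⟩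
    exact ⟨g '' L, (hg L).2 hL, Set.mem_image_of_mem g h1, Set.mem_image_of_mem g h2,
      Set.mem_image_of_mem g h3⟩
  · rintro ⟨L, hL, h1, h2, h3⟩
    exact ⟨g ⁻¹' L, (hg _).1 (by rwa [Set.image_preimage_eq _ g.surjective]), h1, h2, h3⟩

/-- The fundamental theorem of projective geometry for permutations of the points. -/
theorem exists_semilinearMap_of_mem_collineationGroup
    (h3 : ∀ x y : V, Submodule.span K {x, y} ≠ ⊤) {g : Equiv.Perm (ℙ K V)}
    (hg : g ∈ collineationGroup K V) :
    ∃ (σ : K →+* K) (φ : V →ₛₗ[σ] V) (hφ : ∀ x, x ≠ 0 → φ x ≠ 0), ∀ x (hx : x ≠ 0),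
      Projectivization.mk K (φ x) (hφ x hx) = g (Projectivization.mk K x hx) := by
  obtain ⟨σ, φ, h⟩ := (isCollineationLift_pointMapLift hg).exists_semilinearMap h3
  have hφ : ∀ x, x ≠ 0 → φ x ≠ 0 := by
    intro x hx
    obtain ⟨a, ha0, ha⟩ := h x
    rw [ha]
    exact smul_ne_zero ha0 (pointMapLift_ne_zero g hx)
  refine ⟨σ, φ, hφ, fun x hx => ?_⟩
  obtain ⟨a, ha0, ha⟩ := h x
  rw [← mk_pointMapLift, Projectivization.mk_eq_mk_iff']
  exact ⟨a, ha.symm⟩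

/-! ### Semilinear maps with a scalar power -/

/-- An additive map that fixes every line through the origin multiplies all vectors by one
scalar. -/
lemma exists_forall_eq_smul (h3 : ∀ x y : V, Submodule.span K {x, y} ≠ ⊤) (T : V →+ V)
    (hT : ∀ x, ∃ c : K, T x = c • x) : ∃ c : K, ∀ x, T x = c • x := by
  have key : ∀ {x y : V} {c : K}, LinearIndependent K ![x, y] → T x = c • x → T y = c • y := by
    intro x y c hxy hc
    obtain ⟨d, hd⟩ := hT y
    obtain ⟨e, he⟩ := hT (x + y)
    rw [map_add, hc, hd] at he
    obtain ⟨h1, h2⟩ := LinearIndependent.pair_iff.1 hxy (c - e) (d - e)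
      (by rw [← sub_eq_zero.2 he]; module)
    rw [hd, sub_eq_zero.1 h2, sub_eq_zero.1 h1]
  obtain ⟨x, hx⟩ : ∃ x : V, x ≠ 0 := by
    by_contra! hv
    exact h3 0 0 (eq_top_iff.2 fun u _ => by simp [hv u])
  obtain ⟨u, hu⟩ : ∃ u, u ∉ Submodule.span K {x, x} := by
    by_contra! hu
    exact h3 x x (eq_top_iff.2 fun u _ => hu u)
  have hxu : LinearIndependent K ![x, u] := by
    rw [LinearIndependent.pair_iff' hx]
    rintro a rfl
    exact hu (Submodule.smul_mem _ a (Submodule.subset_span (by simp)))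
  obtain ⟨c, hc⟩ := hT x
  refine ⟨c, fun y => ?_⟩
  by_cases hxy : LinearIndependent K ![x, y]
  · exact key hxy hc
  obtain ⟨a, rfl⟩ : ∃ a : K, a • x = y := by
    rw [LinearIndependent.pair_iff' hx] at hxy
    push Not at hxy
    exact hxy
  by_cases ha : a = 0
  · simp [ha]
  · exact key (LinearIndependent.pair_symm_iff.1 (linearIndependent_smul_left hxu ha))
      (key hxu hc)

/-- If a collineation has trivial `r`-th power, then the `r`-th power of an inducing semilinear map
is scalar, and so the `r`-th power of the field endomorphism is trivial. -/
lemma exists_iterate_eq_smul (h3 : ∀ x y : V, Submodule.span K {x, y} ≠ ⊤)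
    {g : Equiv.Perm (ℙ K V)} {σ : K →+* K} {φ : V →ₛₗ[σ] V} (hφ : ∀ x, x ≠ 0 → φ x ≠ 0)
    (hg : ∀ x (hx : x ≠ 0),
      Projectivization.mk K (φ x) (hφ x hx) = g (Projectivization.mk K x hx))
    {r : ℕ} (hgr : g ^ r = 1) :
    σ ^ r = 1 ∧ ∃ c : K, ∀ x, φ^[r] x = c • x := by
  have hne : ∀ (n : ℕ) (x : V), x ≠ 0 → φ^[n] x ≠ 0 := by
    intro n
    induction n with
    | zero => exact fun x hx => hx
    | succ n ih => exact fun x hx => ih _ (hφ x hx)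
  have hmk : ∀ (n : ℕ) (x : V) (hx : x ≠ 0), Projectivization.mk K (φ^[n] x) (hne n x hx)
      = (g ^ n) (Projectivization.mk K x hx) := by
    intro n
    induction n with
    | zero => exact fun x hx => rfl
    | succ n ih =>
      intro x hx
      rw [pow_succ, Equiv.Perm.mul_apply, ← hg, ← ih _ (hφ x hx)]
      rfl
  have hsmul : ∀ (n : ℕ) (a : K) (x : V), φ^[n] (a • x) = (σ ^ n) a • φ^[n] x := by
    intro n
    induction n with
    | zero => exact fun a x => rfl
    | succ n ih =>
      intro a x
      rw [Function.iterate_succ_apply, Function.iterate_succ_apply, map_smulₛₗ, ih, pow_succ]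
      rfl
  obtain ⟨c, hc⟩ := exists_forall_eq_smul h3
    (⟨⟨φ^[r], iterate_map_zero φ r⟩, iterate_map_add φ r⟩ : V →+ V) (by
      intro x
      by_cases hx : x = 0
      · exact ⟨0, by rw [hx, map_zero, smul_zero]⟩
      have h := hmk r x hx
      rw [hgr, Equiv.Perm.one_apply, Projectivization.mk_eq_mk_iff'] at h
      obtain ⟨a, ha⟩ := h
      exact ⟨a, ha.symm⟩)
  replace hc : ∀ x, φ^[r] x = c • x := hc
  refine ⟨?_, c, hc⟩
  obtain ⟨x, hx⟩ : ∃ x : V, x ≠ 0 := by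
    by_contra! hv
    exact h3 0 0 (eq_top_iff.2 fun u _ => by simp [hv u])
  ext a
  have h := hsmul r a x
  rw [hc, hc, smul_smul, smul_smul] at h
  have hc0 : c ≠ 0 := by
    rintro rfl
    exact hne r x hx (by rw [hc, zero_smul])
  rw [RingHom.one_def, RingHom.id_apply]
  exact mul_right_cancel₀ hc0 (by rw [mul_comm a]; exact (smul_left_injective K hx h).symm)

end Collineations

/-- Write `N a = a * σ a`. Taking determinants of the matrix identity behind `φ ∘ φ = c` gives
`c ^ n = N (det φ)`, and as `n` is odd and `σ c = c`, the scalar `c` is itself a norm `N μ`. Then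
`μ⁻¹ φ` is an involution, so `v + μ⁻¹ φ v` is fixed by it for every `v`. If this vector vanishes,
then `v` is an eigenvector instead. -/
lemma exists_eq_smul_of_apply_apply_eq_smul {F : Type*} [Field F] {n : ℕ} (hn : Odd n) {σ : F →+* F}
    {φ : (Fin n → F) →ₛₗ[σ] (Fin n → F)} (hφ : ∀ x, x ≠ 0 → φ x ≠ 0) {c : F}
    (hc : ∀ x, φ (φ x) = c • x) : ∃ x, x ≠ 0 ∧ ∃ a : F, φ x = a • x := by
  have : NeZero n := ⟨hn.pos.ne'⟩
  obtain ⟨v, hv⟩ := exists_ne (0 : Fin n → F)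
  have hc0 : c ≠ 0 := by
    rintro rfl
    exact hφ _ (hφ v hv) (by rw [hc, zero_smul])
  have hσc : σ c = c := by
    have h : φ (φ (φ v)) = σ c • φ v := by rw [hc v, map_smulₛₗ]
    exact smul_left_injective F (hφ v hv) (h.symm.trans (hc (φ v)))
  -- The matrix of `φ` in the standard basis.
  set A : Matrix (Fin n) (Fin n) F := Matrix.of fun i j => φ (Pi.single j 1) i
  have hmul : A * σ.mapMatrix A = c • (1 : Matrix (Fin n) (Fin n) F) := by
    ext k j
    have h1 := congrFun (hc (Pi.single j 1)) k
    rw [pi_eq_sum_univ' (φ (Pi.single j 1)), map_sum] at h1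
    simp only [map_smulₛₗ, Finset.sum_apply, Pi.smul_apply, smul_eq_mul] at h1
    rw [Matrix.mul_apply, Matrix.smul_apply, smul_eq_mul, Matrix.one_apply, ← Pi.single_apply,
      ← h1]
    refine Finset.sum_congr rfl fun i _ => ?_
    rw [mul_comm]
    rfl
  have hdet : A.det * σ A.det = c ^ n := by
    rw [RingHom.map_det, ← Matrix.det_mul, hmul, Matrix.det_smul, Matrix.det_one, mul_one,
      Fintype.card_fin]
  -- With `n = 2 * k + 1` and `N (c ^ k) = c ^ (2 * k)`, the quotient `det A / c ^ k` has norm `c`.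
  obtain ⟨k, rfl⟩ := hn
  obtain ⟨μ, hμ⟩ : ∃ μ : F, μ * σ μ = c := by
    refine ⟨A.det / c ^ k, ?_⟩
    rw [map_div₀, map_pow, hσc, div_mul_div_comm, hdet, ← pow_add, div_eq_iff (pow_ne_zero _ hc0)]
    ring
  by_cases hu : φ v + μ • v = 0
  · exact ⟨v, hv, -μ, by rw [eq_neg_of_add_eq_zero_left hu, neg_smul]⟩
  · refine ⟨_, hu, σ μ, ?_⟩
    rw [map_add, hc, map_smulₛₗ, smul_add, smul_smul, ← hμ, mul_comm μ]
    exact add_comm _ _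

/-! ### Fixed points of collineations of prime order -/

theorem exists_fixedPoint_of_pow_prime_eq_one {F : Type*} [Field F] [IsAlgClosed F] {n : ℕ}
    (hn : Odd n) (hn3 : 3 ≤ n) {g : Equiv.Perm (ℙ F (Fin n → F))}
    (hg : g ∈ collineationGroup F (Fin n → F)) {r : ℕ} (hr : r.Prime) (hgr : g ^ r = 1) :
    ∃ p, g p = p := by
  have h3 : ∀ x y : Fin n → F, Submodule.span F {x, y} ≠ ⊤ := by
    intro x y h
    have h1 := finrank_range_le_card (R := F) ![x, y]
    rw [Matrix.range_cons_cons_empty, Set.finrank, h, finrank_top, Module.finrank_fin_fun,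
      Fintype.card_fin] at h1
    omega
  obtain ⟨σ, φ, hφ, hφg⟩ := exists_semilinearMap_of_mem_collineationGroup h3 hg
  obtain ⟨hσr, c, hc⟩ := exists_iterate_eq_smul h3 hφ hφg hgr
  obtain ⟨x, hx, a, ha⟩ : ∃ x, x ≠ 0 ∧ ∃ a : F, φ x = a • x := by
    by_cases hσ : σ = 1
    · subst hσ
      have : NeZero n := ⟨by omega⟩
      let T : Module.End F (Fin n → F) := ⟨⟨φ, map_add φ⟩, fun a x => map_smulₛₗ φ a x⟩
      obtain ⟨a, ha⟩ := Module.End.exists_eigenvalue T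
      obtain ⟨x, hx⟩ := ha.exists_hasEigenvector
      exact ⟨x, hx.2, a, hx.apply_eq_smul⟩
    · obtain rfl := eq_two_of_pow_prime_eq_one hr hσr hσ
      exact exists_eq_smul_of_apply_apply_eq_smul hn hφ hc
  refine ⟨Projectivization.mk F x hx, ?_⟩
  rw [← hφg, Projectivization.mk_eq_mk_iff']
  exact ⟨a, ha.symm⟩

theorem isTorsionFreeGroup_of_isSingerGroup {F : Type*} [Field F] [IsAlgClosed F] {n : ℕ}
    (hn : Odd n) (hn3 : 3 ≤ n) {S : Subgroup (collineationGroup F (Fin n → F))}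
    (hS : IsSingerGroup S) : IsTorsionFreeGroup S := by
  intro g hg
  by_contra hg1
  obtain ⟨r, hr, hrg⟩ := Nat.exists_prime_and_dvd (mt orderOf_eq_one_iff.1 hg1)
  obtain ⟨s, hs⟩ : ∃ s, s = g ^ (orderOf g / r) := ⟨_, rfl⟩
  have hos : orderOf s = r := by rw [hs, orderOf_pow_orderOf_div hg.orderOf_pos.ne' hrg]
  have hsr : ((s : collineationGroup F (Fin n → F)) : Equiv.Perm (ℙ F (Fin n → F))) ^ r = 1 := by
    rw [← Subgroup.coe_pow, ← Subgroup.coe_pow, ← hos, pow_orderOf_eq_one]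
    rfl
  obtain ⟨p, hp⟩ := exists_fixedPoint_of_pow_prime_eq_one hn hn3 s.1.2 hr hsr
  have hs1 : s = 1 := (hS p p).unique hp rfl
  rw [hs1, orderOf_one] at hos
  exact hr.one_lt.ne hos

theorem mainTheorem6 {F : Type*} [Field F] [IsAlgClosed F] (m : ℕ) (hm : 1 ≤ m)
    (hodd : Odd (m + 1)) (S : Subgroup (collineationGroup F (Fin (m + 1) → F)))
    (hS : IsSingerGroup S) :
    (ringChar F ≠ 0 → IsTorsionFreeGroup S) ∧
      (ringChar F = 0 → m = 2 → IsTorsionFreeGroup S) := by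
  have hm3 : 3 ≤ m + 1 := by
    obtain ⟨k, hk⟩ := hodd
    omega
  -- The fixed point argument is independent of the characteristic and of `m`.
  have h := isTorsionFreeGroup_of_isSingerGroup hodd hm3 hS
  exact ⟨fun _ => h, fun _ _ => h⟩
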